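/- **Setting.** Let $\mathcal P$ be a finite set of processes, and let $\mathcal B$ be the set of Byzantine nodes; $\mathcal W=\mathcal P\setminus\mathcal B$ is the set of well-behaved processes. There is a designated sender $s$, which is either a process of $\mathcal P$ or a separate node, and which may be Byzantine or well-behaved. A heterogeneous quorum system $\mathcal Q$ assigns to every process $p$ a non-empty set $\mathcal Q(p)$ of non-empty subsets of $\mathcal P$, none of which properly contains another (the individual minimal quorums of $p$); the quorums of Byzantine processes are arbitrary. - $\mathcal Q$ has *quorum intersection* if $q\cap q'\cap\mathcal W\neq\emptyset$ for all $p,p'\in\mathcal W$, $q\in\mathcal Q(p)$, $q'\in\mathcal Q(p')$. - A quorum $q$ is *complete* if $q\subseteq\mathcal W$ and every $p\in q$ has a quorum $q'\in\mathcal Q(p)$ with $q'\subseteq q$. - $\mathcal Q$ has *strong availability* for a set $P$ of processes if every $p\in P$ has a complete quorum $q\in\mathcal Q(p)$. - The *followers* of $p'$ are the processes $p\in\mathcal P$ such that $p'\in q$ for some $q\in\mathcal Q(p)$. A set $X$ is *$p$-blocking* if $X\cap q\ne\emptyset$ for every $q\in\mathcal Q(p)$. **Protocol.** Each well-behaved process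 $p$ keeps flags *echoed*, *readied*, *delivered* (initially false) and, for every value $v$, sets $E(v),R(v)$ (initially empty), and reacts to its inputs as follows. 1. On a request to broadcast $v$ (at the sender): send $\mathrm{BCast}(v)$ to every process in $\mathcal P$. 2. On receiving $\mathrm{BCast}(v)$ from $s$: if not *echoed*, set *echoed* and send $\mathrm{Echo}(v)$ to all followers of $p$. ($\mathrm{BCast}$ messages from other nodes are ignored.) 3. On receiving $\mathrm{Echo}(v)$ from $p'$: add $p'$ to $E(v)$; if not *readied* and $q\subseteq E(v)$ for some $q\in\mathcal Q(p)$, set *readied* and send $\mathrm{Ready}(v)$ to all followers of $p$. 4. On receiving $\mathrm{Ready}(v)$ from $p'$: add $p'$ to $R(v)$; if not *readied* and $R(v)$ is $p$-blocking, set *readied* and send $\mathrm{Ready}(v)$ to all followers of $p$; then, if not *delivered* and $q\subseteq R(v)$ for some $q\in\mathcal Q(p)$, set *delivered* and deliver $v$. A well-behaved sender outside $\mathcal P$ only performs item 1. **Executions.** In an execution, the well-behaved nodes handle their inputs one at a time according to the protocol, and Byzantine nodes behave arbitrarily. Communication is by authenticated, reliable, asynchronous point-to-point links: a message received from a well-behaved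 node was sent by it before, and every message sent by a well-behaved node to a well-behaved process is eventually received. At most one broadcast request is issued, and it is issued at the designated sender. **Theorem.** Let $\mathcal Q$ be a heterogeneous quorum system that has quorum intersection, and let $P\subseteq\mathcal W$ be a non-empty set of well-behaved processes for which $\mathcal Q$ has strong availability. Then the above protocol implements Byzantine reliable broadcast: every execution satisfies - *Validity for $P$:* if a well-behaved sender broadcasts $m$, then every process in $P$ eventually delivers $m$; - *Integrity:* if a well-behaved process delivers $m$ and the sender is well-behaved, then the sender previously broadcast $m$; - *Totality for $P$:* if a well-behaved process delivers a message, then every process in $P$ eventually delivers a message; - *Consistency:* no two well-behaved processes deliver different messages; - *No duplication:* every well-behaved process delivers at most one message (and at most once). -/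

import Mathlib

/-! ### Processes and heterogeneous quorum systems -/

/-- The setting of an execution of a broadcast protocol: a finite set `procs` of system
processes, the set `byz` of Byzantine nodes, and the designated sender, which is either one of the
system processes or a separate node. -/
structure BSystem (Node : Type*) where
  procs : Set Node
  finite_procs : procs.Finite
  byz : Set Node
  sender : Node

/-- The well-behaved system processes. -/
def BSystem.wellBehaved {Node : Type*} (S : BSystem Node) : Set Node :=
  S.procs \ S.byz

/-- A heterogeneous quorum system: every process has a non-empty set of individual minimal
quorums, which are non-empty sets of processes none of which properly contains another one.
The quorums of Byzantine processes are left unspecified (arbitrary). -/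
structure QuorumSystem {Node : Type*} (S : BSystem Node) where
  quorums : Node → Set (Set Node)
  nonempty : ∀ p ∈ S.wellBehaved, (quorums p).Nonempty
  quorum_nonempty : ∀ p ∈ S.wellBehaved, ∀ q ∈ quorums p, q.Nonempty
  quorum_subset : ∀ p ∈ S.wellBehaved, ∀ q ∈ quorums p, q ⊆ S.procs
  minimal : ∀ p ∈ S.wellBehaved, IsAntichain (· ⊆ ·) (quorums p)

namespace QuorumSystem

/-- Any two quorums of well-behaved processes intersect at a well-behaved process. -/
def QuorumIntersection {Node : Type*} {S : BSystem Node} (Q : QuorumSystem S) : Prop :=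
  ∀ p ∈ S.wellBehaved, ∀ p' ∈ S.wellBehaved, ∀ q ∈ Q.quorums p, ∀ q' ∈ Q.quorums p',
    (q ∩ q' ∩ S.wellBehaved).Nonempty

/-- `Q` is quorum subsuming for `q`: every process in `q` has a quorum included in `q`. -/
def QuorumSubsuming {Node : Type*} {S : BSystem Node} (Q : QuorumSystem S) (q : Set Node) : Prop :=
  ∀ p ∈ q, ∃ q' ∈ Q.quorums p, q' ⊆ q

/-- A quorum is complete if all its members are well-behaved and `Q` is quorum subsuming for it. -/
def IsComplete {Node : Type*} {S : BSystem Node} (Q : QuorumSystem S) (q : Set Node) : Prop :=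
  q ⊆ S.wellBehaved ∧ Q.QuorumSubsuming q

/-- Strong availability for `P`: every process in `P` has at least one complete quorum. -/
def StrongAvailability {Node : Type*} {S : BSystem Node} (Q : QuorumSystem S) (P : Set Node) :
    Prop :=
  ∀ p ∈ P, ∃ q ∈ Q.quorums p, Q.IsComplete q

/-- The followers of `p'`: the processes that have a quorum containing `p'`. -/
def followers {Node : Type*} {S : BSystem Node} (Q : QuorumSystem S) (p' : Node) : Set Node :=
  {p ∈ S.procs | ∃ q ∈ Q.quorums p, p' ∈ q}

end QuorumSystem

/-- `X` is a blocking set for a process whose individual minimal quorums are `Qs`: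
it intersects every quorum. -/
def IsBlocking {Node : Type*} (Qs : Set (Set Node)) (X : Set Node) : Prop :=
  ∀ q ∈ Qs, (X ∩ q).Nonempty

/-! ### Protocol components and their executions -/

/-- Inputs of a component on top of point-to-point links: a request of its user,
or the receipt of a message together with the identity of the node that sent it. -/
inductive BInput (Node Req Msg : Type*) where
  | request (r : Req)
  | receive (src : Node) (m : Msg)

/-- Outputs of a component: a message to be sent, or a response to its user. -/
inductive BOutput (Node Resp Msg : Type*) where
  | send (dst : Node) (m : Msg)
  | response (r : Resp)

/-- A (deterministic) component: an initial local state, and a handler which maps the current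
local state and an input to the next local state and the outputs. -/
structure Component (Node Req Resp Msg State : Type*) where
  init : State
  handle : State → BInput Node Req Msg → State × Set (BOutput Node Resp Msg)

section Runs

variable {Node Req Resp Msg State : Type*}

open Classical in
/-- The local state of node `p` before step `t`, if node `p` runs the component `C p` and
`ev t = some (p, i)` says that at step `t` node `p` handles the input `i`. -/
noncomputable def localState (C : Node → Component Node Req Resp Msg State)
    (ev : ℕ → Option (Node × BInput Node Req Msg)) : ℕ → Node → State
  | 0, p => (C p).init
  | t + 1, p =>
    match ev t with
    | some (p', i) =>
      if p' = p then ((C p).handle (localState C ev t p) i).1 else localState C ev t p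
    | none => localState C ev t p

/-- Node `p` produces the output `o` at step `t`. -/
def HasOutput (C : Node → Component Node Req Resp Msg State)
    (ev : ℕ → Option (Node × BInput Node Req Msg)) (t : ℕ) (p : Node)
    (o : BOutput Node Resp Msg) : Prop :=
  ∃ i, ev t = some (p, i) ∧ o ∈ ((C p).handle (localState C ev t p) i).2

/-- An infinite execution in which the well-behaved nodes run the components `C`. Each step is
either the handling of one input by a well-behaved node, or `none` (nothing visible to the
well-behaved nodes happens). Byzantine nodes are unrestricted: messages from a Byzantine source may
be received at any time, with any content. Links are authenticated and reliable: a message that is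
received from a well-behaved source was sent by it before, and a message between well-behaved nodes
is eventually received, with no bound on the delay. The user issues at most one request, at the
designated sender. -/
structure Execution (S : BSystem Node) (C : Node → Component Node Req Resp Msg State) where
  event : ℕ → Option (Node × BInput Node Req Msg)
  receive_at : ∀ t p src m, event t = some (p, .receive src m) → p ∈ S.wellBehaved
  request_at : ∀ t p r, event t = some (p, .request r) → p = S.sender ∧ p ∉ S.byz
  request_once : ∀ t t' p p' r r', event t = some (p, .request r) →
    event t' = some (p', .request r') → t = t'
  authentic : ∀ t p src m, event t = some (p, .receive src m) → src ∉ S.byz →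
    ∃ t' < t, HasOutput C event t' src (.send p m)
  reliable : ∀ t src dst m, src ∉ S.byz → dst ∈ S.wellBehaved →
    HasOutput C event t src (.send dst m) → ∃ t' > t, event t' = some (dst, .receive src m)

end Runs

/-! ### Specification of Byzantine reliable broadcast -/

namespace Execution

variable {Node V Msg State : Type*} {S : BSystem Node} {C : Node → Component Node V V Msg State}

/-- At step `t`, the well-behaved sender handles the request to broadcast `m`. -/
def Broadcasts (x : Execution S C) (t : ℕ) (m : V) : Prop :=
  x.event t = some (S.sender, .request m)

/-- At step `t`, process `p` delivers `m`. -/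
def Delivers (x : Execution S C) (t : ℕ) (p : Node) (m : V) : Prop :=
  HasOutput C x.event t p (.response m)

/-- If a well-behaved sender broadcasts `m`, then every process in `P` eventually delivers `m`. -/
def Validity (x : Execution S C) (P : Set Node) : Prop :=
  S.sender ∉ S.byz → ∀ t m, x.Broadcasts t m → ∀ p ∈ P, ∃ t' > t, x.Delivers t' p m

/-- If a well-behaved process delivers `m` and the sender is well-behaved, then the sender
broadcast `m` before. -/
def Integrity (x : Execution S C) : Prop :=
  S.sender ∉ S.byz → ∀ p ∈ S.wellBehaved, ∀ t m, x.Delivers t p m → ∃ t' < t, x.Broadcasts t' m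

/-- If some well-behaved process delivers a message, then every process in `P` delivers a message
at some time. -/
def Totality (x : Execution S C) (P : Set Node) : Prop :=
  (∃ p ∈ S.wellBehaved, ∃ t m, x.Delivers t p m) → ∀ p ∈ P, ∃ t m, x.Delivers t p m

/-- No two well-behaved processes deliver different messages. -/
def Consistency (x : Execution S C) : Prop :=
  ∀ p ∈ S.wellBehaved, ∀ p' ∈ S.wellBehaved, ∀ t t' m m',
    x.Delivers t p m → x.Delivers t' p' m' → m = m'

/-- Every well-behaved process delivers at most one message, at most once. -/
def NoDuplication (x : Execution S C) : Prop :=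
  ∀ p ∈ S.wellBehaved, ∀ t t' m m', x.Delivers t p m → x.Delivers t' p m' → t = t' ∧ m = m'

end Execution

/-- The protocol `C` implements Byzantine reliable broadcast in `S`, with validity and totality
for the set `P`: every execution has the required properties. -/
def ImplementsBRB {Node V Msg State : Type*} (S : BSystem Node)
    (C : Node → Component Node V V Msg State) (P : Set Node) : Prop :=
  ∀ x : Execution S C,
    x.Validity P ∧ x.Integrity ∧ x.Totality P ∧ x.Consistency ∧ x.NoDuplication

/-! ### The Bracha-style protocol for heterogeneous quorum systems -/

/-- Messages of the protocol. -/
inductive BrachaMsg (V : Type*) where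
  | bcast (v : V)
  | echo (v : V)
  | ready (v : V)

/-- Local state: the flags, and for every value the sets of processes from which an echo,
respectively a ready message for that value was received. -/
structure BrachaState (Node V : Type*) where
  echoed : Bool
  readied : Bool
  delivered : Bool
  E : V → Set Node
  R : V → Set Node

/-- The outputs that send `m` to every node in `D`. -/
def sendAll {Node V : Type*} (D : Set Node) (m : BrachaMsg V) :
    Set (BOutput Node V (BrachaMsg V)) :=
  {o | ∃ p ∈ D, o = .send p m}

open Classical in
/-- The component of a process which knows the set `procs` of all processes, the identity of the
sender, its own individual minimal quorums `Qs` and its followers `F`. -/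
noncomputable def brachaComponent {Node : Type*} (V : Type*) (procs : Set Node) (sender : Node)
    (Qs : Set (Set Node)) (F : Set Node) :
    Component Node V V (BrachaMsg V) (BrachaState Node V) where
  init := ⟨false, false, false, fun _ => ∅, fun _ => ∅⟩
  handle st
    | .request v => (st, sendAll procs (.bcast v))
    | .receive p' (.bcast v) =>
      if p' = sender ∧ st.echoed = false then
        ({ st with echoed := true }, sendAll F (.echo v))
      else (st, ∅)
    | .receive p' (.echo v) =>
      let st₁ := { st with E := Function.update st.E v (st.E v ∪ {p'}) }
      if st₁.readied = false ∧ ∃ q ∈ Qs, q ⊆ st₁.E v then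
        ({ st₁ with readied := true }, sendAll F (.ready v))
      else (st₁, ∅)
    | .receive p' (.ready v) =>
      let st₁ := { st with R := Function.update st.R v (st.R v ∪ {p'}) }
      let r : BrachaState Node V × Set (BOutput Node V (BrachaMsg V)) :=
        if st₁.readied = false ∧ IsBlocking Qs (st₁.R v) then
          ({ st₁ with readied := true }, sendAll F (.ready v))
        else (st₁, ∅)
      if r.1.delivered = false ∧ ∃ q ∈ Qs, q ⊆ r.1.R v then
        ({ r.1 with delivered := true }, r.2 ∪ {.response v})
      else r

/-- The protocol: every process runs the component with its own quorums and followers. -/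
noncomputable def QuorumSystem.bracha {Node : Type*} {S : BSystem Node} (Q : QuorumSystem S)
    (V : Type*) (p : Node) : Component Node V V (BrachaMsg V) (BrachaState Node V) :=
  brachaComponent V S.procs S.sender (Q.quorums p) (Q.followers p)

/-! Each flag lets a well-behaved process echo, ready and deliver at most once, hence for one value.
Consistency follows at once: the ready quorums behind two deliveries share a well-behaved process. A
well-behaved process may be blocked by Byzantine nodes alone, so its ready message need not be
backed by echoes. Inside a complete quorum this cannot happen: a set blocking a member meets a
quorum included in the complete one, so the cause is an earlier ready of another member or the same
one, and descent in time ends at an echo quorum (`ReadiesAt.exists_echo_quorum`). Echo quorums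
intersect, so all members ready the same value (`ReadiesAt.eq_of_mem_complete`), and with a
well-behaved sender it is the broadcast one. Every delivery rests on a ready from such a member,
which gives integrity. For totality, the well-behaved part of a ready quorum blocks every
well-behaved process (`exists_readiesAt_of_readiesAt`), so a whole complete quorum readies, for one
value. For validity, a complete quorum echoes, then readies the broadcast value, and integrity
identifies what is delivered. -/

namespace Execution

variable {Node Req Resp Msg State : Type*} {S : BSystem Node}
  {C : Node → Component Node Req Resp Msg State}

/-- The nodes from which `p` received the message `m` before step `t`. -/
def receivedFrom (x : Execution S C) (t : ℕ) (p : Node) (m : Msg) : Set Node :=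
  {src | ∃ t' < t, x.event t' = some (p, .receive src m)}

/-- A message that is received from every member of a finite non-empty set is at some step received
from a member of the set by which time it has been received from all of them. -/
theorem exists_last_receive (x : Execution S C) {X : Set Node} (hfin : X.Finite)
    (hne : X.Nonempty) {p : Node} {m : Msg}
    (h : ∀ src ∈ X, ∃ t, x.event t = some (p, .receive src m)) :
    ∃ t, ∃ src ∈ X, x.event t = some (p, .receive src m) ∧ X ⊆ x.receivedFrom (t + 1) p m := by
  choose! f hf using h
  -- With one receipt time fixed per member, the member with the largest time is the last one.
  obtain ⟨a, ha, hmax⟩ := hfin.exists_maximalFor f X hne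
  refine ⟨f a, a, ha, hf a ha, fun b hb => ⟨f b, ?_, hf b hb⟩⟩
  have := hmax hb
  omega

end Execution

namespace QuorumSystem

variable {Node V : Type*} {S : BSystem Node} {Q : QuorumSystem S}

open Execution

/-- At step `t`, process `p` sends an echo for `v` to its followers. -/
def EchoesAt (x : Execution S (Q.bracha V)) (t : ℕ) (p : Node) (v : V) : Prop :=
  x.event t = some (p, .receive S.sender (.bcast v)) ∧
    (localState (Q.bracha V) x.event t p).echoed = false

/-- At step `t`, process `p` sends a ready message for `v` to its followers. -/
def ReadiesAt (x : Execution S (Q.bracha V)) (t : ℕ) (p : Node) (v : V) : Prop :=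
  (localState (Q.bracha V) x.event t p).readied = false ∧ ∃ src,
    (x.event t = some (p, .receive src (.echo v)) ∧
      ∃ q ∈ Q.quorums p, q ⊆ x.receivedFrom (t + 1) p (.echo v)) ∨
    (x.event t = some (p, .receive src (.ready v)) ∧
      IsBlocking (Q.quorums p) (x.receivedFrom (t + 1) p (.ready v)))

/-- At step `t`, process `p` collects a quorum of ready messages for `v` and has not delivered
before. -/
def CompletesAt (x : Execution S (Q.bracha V)) (t : ℕ) (p : Node) (v : V) : Prop :=
  (localState (Q.bracha V) x.event t p).delivered = false ∧ ∃ src,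
    x.event t = some (p, .receive src (.ready v)) ∧
      ∃ q ∈ Q.quorums p, q ⊆ x.receivedFrom (t + 1) p (.ready v)

/-! ### Local states in terms of the received messages -/

theorem localState_succ (x : Execution S (Q.bracha V)) {t : ℕ} {p : Node}
    {i : BInput Node V (BrachaMsg V)} (h : x.event t = some (p, i)) :
    localState (Q.bracha V) x.event (t + 1) p =
      ((Q.bracha V p).handle (localState (Q.bracha V) x.event t p) i).1 := by
  simp [localState, h]

theorem localState_succ_of_ne (x : Execution S (Q.bracha V)) {t : ℕ} {p : Node}
    (h : ∀ i, x.event t ≠ some (p, i)) :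
    localState (Q.bracha V) x.event (t + 1) p = localState (Q.bracha V) x.event t p := by
  rw [localState]
  rcases he : x.event t with _ | ⟨p', i⟩
  · rfl
  · have : p' ≠ p := fun hp => h i (by rw [he, hp])
    simp [this]

theorem receivedFrom_succ (x : Execution S (Q.bracha V)) (t : ℕ) (p : Node) (m : BrachaMsg V) :
    x.receivedFrom (t + 1) p m =
      x.receivedFrom t p m ∪ {src | x.event t = some (p, .receive src m)} := by
  ext src
  simp only [receivedFrom, Set.mem_ofPred_eq, Set.mem_union]
  constructor
  · rintro ⟨t', ht', h⟩
    rcases Nat.lt_succ_iff_lt_or_eq.mp ht' with h1 | rfl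
    exacts [Or.inl ⟨t', h1, h⟩, Or.inr h]
  · rintro (⟨t', ht', h⟩ | h)
    exacts [⟨t', by omega, h⟩, ⟨t, by omega, h⟩]

-- Writing flags as disjunctions and outputs as guarded sets removes the branching of the handler,
-- so later case analyses are uniform.
open Classical in
theorem handle_bcast (p src : Node) (st : BrachaState Node V) (v : V) :
    (Q.bracha V p).handle st (.receive src (.bcast v)) =
      ({ st with echoed := st.echoed || decide (src = S.sender) },
        {o | (st.echoed = false ∧ src = S.sender) ∧ o ∈ sendAll (Q.followers p) (.echo v)}) := by
  obtain ⟨e, r, d, E, R⟩ := st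
  by_cases h : src = S.sender <;> cases e <;> simp [bracha, brachaComponent, h]

open Classical in
theorem handle_echo (p src : Node) (st : BrachaState Node V) (v : V) :
    (Q.bracha V p).handle st (.receive src (.echo v)) =
      ({ st with
          E := Function.update st.E v (st.E v ∪ {src})
          readied := st.readied || decide (∃ q ∈ Q.quorums p, q ⊆ st.E v ∪ {src}) },
        {o | (st.readied = false ∧ ∃ q ∈ Q.quorums p, q ⊆ st.E v ∪ {src}) ∧
          o ∈ sendAll (Q.followers p) (.ready v)}) := by
  obtain ⟨e, r, d, E, R⟩ := st
  by_cases h : ∃ q ∈ Q.quorums p, q ⊆ E v ∪ {src} <;> cases r <;>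
    simp only [bracha, brachaComponent, Function.update_self, h] <;> simp

-- The two tests decouple because setting `readied` changes neither `R` nor `delivered`.
open Classical in
theorem handle_ready (p src : Node) (st : BrachaState Node V) (v : V) :
    (Q.bracha V p).handle st (.receive src (.ready v)) =
      ({ st with
          R := Function.update st.R v (st.R v ∪ {src})
          readied := st.readied || decide (IsBlocking (Q.quorums p) (st.R v ∪ {src}))
          delivered := st.delivered || decide (∃ q ∈ Q.quorums p, q ⊆ st.R v ∪ {src}) },
        {o | (st.readied = false ∧ IsBlocking (Q.quorums p) (st.R v ∪ {src})) ∧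
            o ∈ sendAll (Q.followers p) (.ready v) ∨
          (st.delivered = false ∧ ∃ q ∈ Q.quorums p, q ⊆ st.R v ∪ {src}) ∧
            o = .response v}) := by
  obtain ⟨e, r, d, E, R⟩ := st
  simp only [bracha, brachaComponent, Function.update_self]
  generalize R v ∪ {src} = X
  by_cases h : ∃ q ∈ Q.quorums p, q ⊆ X <;> by_cases hb : IsBlocking (Q.quorums p) X <;>
    cases r <;> cases d <;> simp [h, hb, Set.insert_def, or_comm]

theorem handle_request (p : Node) (st : BrachaState Node V) (v : V) :
    (Q.bracha V p).handle st (.request v) = (st, sendAll S.procs (.bcast v)) := rfl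

theorem echoes_and_readies_eq (x : Execution S (Q.bracha V)) (t : ℕ) (p : Node) (v : V) :
    (localState (Q.bracha V) x.event t p).E v = x.receivedFrom t p (.echo v) ∧
      (localState (Q.bracha V) x.event t p).R v = x.receivedFrom t p (.ready v) := by
  induction t with
  | zero => simp [localState, receivedFrom, bracha, brachaComponent]
  | succ t ih =>
    rw [receivedFrom_succ, receivedFrom_succ, ← ih.1, ← ih.2]
    by_cases h : ∃ i, x.event t = some (p, i)
    · obtain ⟨i, hi⟩ := h
      rw [localState_succ x hi]
      rcases i with w | ⟨src, w | w | w⟩ <;>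
        simp only [handle_request, handle_bcast, handle_echo, handle_ready, hi] <;>
        -- Both orientations of the inequality are kept for `simp`.
        rcases (eq_or_ne v w).imp_right fun h => And.intro h h.symm with rfl | ⟨hw, hw'⟩ <;>
        simp_all [Set.ext_iff]
    · push Not at h
      rw [localState_succ_of_ne x h]
      simp [h]

theorem E_eq (x : Execution S (Q.bracha V)) (t : ℕ) (p : Node) (v : V) :
    (localState (Q.bracha V) x.event t p).E v = x.receivedFrom t p (.echo v) :=
  (echoes_and_readies_eq x t p v).1

theorem R_eq (x : Execution S (Q.bracha V)) (t : ℕ) (p : Node) (v : V) :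
    (localState (Q.bracha V) x.event t p).R v = x.receivedFrom t p (.ready v) :=
  (echoes_and_readies_eq x t p v).2

theorem echoed_succ (x : Execution S (Q.bracha V)) (t : ℕ) (p : Node) :
    (localState (Q.bracha V) x.event (t + 1) p).echoed = true ↔
      (localState (Q.bracha V) x.event t p).echoed = true ∨ ∃ v, EchoesAt x t p v := by
  by_cases h : ∃ i, x.event t = some (p, i)
  · obtain ⟨i, hi⟩ := h
    rw [localState_succ x hi]
    unfold EchoesAt
    rcases i with w | ⟨src, w | w | w⟩ <;>
      simp only [handle_request, handle_bcast, handle_echo, handle_ready, hi] <;>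
      cases hf : (localState (Q.bracha V) x.event t p).echoed <;> simp_all
  · push Not at h
    rw [localState_succ_of_ne x h]
    simp [EchoesAt, h]

/-- Matches the set tested by the handler, which already includes the current source, with the
history up to `t + 1`. -/
theorem receivedFrom_succ_of_event (x : Execution S (Q.bracha V)) {t : ℕ} {p src : Node}
    {m : BrachaMsg V} (h : x.event t = some (p, .receive src m)) :
    x.receivedFrom (t + 1) p m = x.receivedFrom t p m ∪ {src} := by
  rw [receivedFrom_succ]
  congr 1
  ext a
  simp [h, eq_comm]

theorem readied_succ (x : Execution S (Q.bracha V)) (t : ℕ) (p : Node) :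
    (localState (Q.bracha V) x.event (t + 1) p).readied = true ↔
      (localState (Q.bracha V) x.event t p).readied = true ∨ ∃ v, ReadiesAt x t p v := by
  by_cases h : ∃ i, x.event t = some (p, i)
  · obtain ⟨i, hi⟩ := h
    rw [localState_succ x hi]
    unfold ReadiesAt
    rcases i with w | ⟨src, w | w | w⟩ <;> (try have hr := receivedFrom_succ_of_event x hi) <;>
      simp only [handle_request, handle_bcast, handle_echo, handle_ready, hi] <;>
      cases hf : (localState (Q.bracha V) x.event t p).readied <;>
      simp_all [E_eq, R_eq]
  · push Not at h
    rw [localState_succ_of_ne x h]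
    simp [ReadiesAt, h]

theorem delivered_succ (x : Execution S (Q.bracha V)) (t : ℕ) (p : Node) :
    (localState (Q.bracha V) x.event (t + 1) p).delivered = true ↔
      (localState (Q.bracha V) x.event t p).delivered = true ∨ ∃ v, CompletesAt x t p v := by
  by_cases h : ∃ i, x.event t = some (p, i)
  · obtain ⟨i, hi⟩ := h
    rw [localState_succ x hi]
    unfold CompletesAt
    rcases i with w | ⟨src, w | w | w⟩ <;> (try have hr := receivedFrom_succ_of_event x hi) <;>
      simp only [handle_request, handle_bcast, handle_echo, handle_ready, hi] <;>
      cases hf : (localState (Q.bracha V) x.event t p).delivered <;>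
      simp_all [R_eq]
  · push Not at h
    rw [localState_succ_of_ne x h]
    simp [CompletesAt, h]

/-! ### Sends and deliveries as events -/

theorem hasOutput_iff (x : Execution S (Q.bracha V)) {t : ℕ} {p : Node}
    {i : BInput Node V (BrachaMsg V)} (h : x.event t = some (p, i))
    {o : BOutput Node V (BrachaMsg V)} : HasOutput (Q.bracha V) x.event t p o ↔
      o ∈ ((Q.bracha V p).handle (localState (Q.bracha V) x.event t p) i).2 := by
  simp [HasOutput, h]

theorem hasOutput_bcast (x : Execution S (Q.bracha V)) {t : ℕ} {p d : Node} {v : V} :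
    HasOutput (Q.bracha V) x.event t p (.send d (.bcast v)) ↔
      x.event t = some (p, .request v) ∧ d ∈ S.procs := by
  by_cases h : ∃ i, x.event t = some (p, i)
  · obtain ⟨i, hi⟩ := h
    rw [hasOutput_iff x hi]
    rcases i with w | ⟨src, w | w | w⟩ <;>
      simp only [handle_request, handle_bcast, handle_echo, handle_ready, hi] <;>
      rcases (eq_or_ne v w).imp_right fun h => And.intro h h.symm with rfl | ⟨hw, hw'⟩ <;>
      simp_all [sendAll, and_assoc]
  · push Not at h
    simp [HasOutput, h]

theorem hasOutput_echo (x : Execution S (Q.bracha V)) {t : ℕ} {p d : Node} {v : V} :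
    HasOutput (Q.bracha V) x.event t p (.send d (.echo v)) ↔
      EchoesAt x t p v ∧ d ∈ Q.followers p := by
  unfold EchoesAt
  by_cases h : ∃ i, x.event t = some (p, i)
  · obtain ⟨i, hi⟩ := h
    rw [hasOutput_iff x hi]
    rcases i with w | ⟨src, w | w | w⟩ <;>
      simp only [handle_request, handle_bcast, handle_echo, handle_ready, hi] <;>
      rcases (eq_or_ne v w).imp_right fun h => And.intro h h.symm with rfl | ⟨hw, hw'⟩ <;>
      simp_all [sendAll, and_assoc, and_left_comm]
  · push Not at h
    simp [HasOutput, h]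

theorem hasOutput_ready (x : Execution S (Q.bracha V)) {t : ℕ} {p d : Node} {v : V} :
    HasOutput (Q.bracha V) x.event t p (.send d (.ready v)) ↔
      ReadiesAt x t p v ∧ d ∈ Q.followers p := by
  unfold ReadiesAt
  by_cases h : ∃ i, x.event t = some (p, i)
  · obtain ⟨i, hi⟩ := h
    rw [hasOutput_iff x hi]
    rcases i with w | ⟨src, w | w | w⟩ <;> (try have hr := receivedFrom_succ_of_event x hi) <;>
      simp only [handle_request, handle_bcast, handle_echo, handle_ready, hi] <;>
      rcases (eq_or_ne v w).imp_right fun h => And.intro h h.symm with rfl | ⟨hw, hw'⟩ <;>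
      simp_all [sendAll, E_eq, R_eq, and_assoc]
  · push Not at h
    simp [HasOutput, h]

theorem delivers_iff (x : Execution S (Q.bracha V)) {t : ℕ} {p : Node} {v : V} :
    x.Delivers t p v ↔ CompletesAt x t p v := by
  unfold Delivers CompletesAt
  by_cases h : ∃ i, x.event t = some (p, i)
  · obtain ⟨i, hi⟩ := h
    rw [hasOutput_iff x hi]
    rcases i with w | ⟨src, w | w | w⟩ <;> (try have hr := receivedFrom_succ_of_event x hi) <;>
      simp only [handle_request, handle_bcast, handle_echo, handle_ready, hi] <;>
      rcases (eq_or_ne v w).imp_right fun h => And.intro h h.symm with rfl | ⟨hw, hw'⟩ <;>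
      simp_all [sendAll, E_eq, R_eq, and_assoc]
  · push Not at h
    simp [HasOutput, h]

/-- A flag that is initially false and is set exactly at the steps satisfying `A` is true
iff such a step occurred before. -/
theorem flag_eq_true_iff {f : ℕ → Bool} {A : ℕ → Prop} (h0 : f 0 = false)
    (hs : ∀ t, f (t + 1) = true ↔ f t = true ∨ A t) (t : ℕ) : f t = true ↔ ∃ t' < t, A t' := by
  induction t with
  | zero => simp [h0]
  | succ t ih =>
    rw [hs, ih]
    constructor
    · rintro (⟨t', h, ha⟩ | ha)
      exacts [⟨t', by omega, ha⟩, ⟨t, by omega, ha⟩]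
    · rintro ⟨t', h, ha⟩
      rcases Nat.lt_succ_iff_lt_or_eq.mp h with h1 | rfl
      exacts [Or.inl ⟨t', h1, ha⟩, Or.inr ha]

/-! ### Flags record past events, so events do not repeat -/

theorem echoed_iff (x : Execution S (Q.bracha V)) (t : ℕ) (p : Node) :
    (localState (Q.bracha V) x.event t p).echoed = true ↔ ∃ t' < t, ∃ v, EchoesAt x t' p v :=
  flag_eq_true_iff (f := fun t => (localState (Q.bracha V) x.event t p).echoed) rfl
    (fun t => echoed_succ x t p) t

theorem readied_iff (x : Execution S (Q.bracha V)) (t : ℕ) (p : Node) :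
    (localState (Q.bracha V) x.event t p).readied = true ↔ ∃ t' < t, ∃ v, ReadiesAt x t' p v :=
  flag_eq_true_iff (f := fun t => (localState (Q.bracha V) x.event t p).readied) rfl
    (fun t => readied_succ x t p) t

theorem delivered_iff (x : Execution S (Q.bracha V)) (t : ℕ) (p : Node) :
    (localState (Q.bracha V) x.event t p).delivered = true ↔
      ∃ t' < t, ∃ v, CompletesAt x t' p v :=
  flag_eq_true_iff (f := fun t => (localState (Q.bracha V) x.event t p).delivered) rfl
    (fun t => delivered_succ x t p) t

theorem EchoesAt.unique {x : Execution S (Q.bracha V)} {t t' : ℕ} {p : Node} {v v' : V}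
    (h : EchoesAt x t p v) (h' : EchoesAt x t' p v') : v = v' := by
  rcases lt_trichotomy t t' with hlt | rfl | hlt
  · have := (echoed_iff x t' p).2 ⟨t, hlt, v, h⟩
    simp [h'.2] at this
  · simpa [h'.1, eq_comm] using h.1
  · have := (echoed_iff x t p).2 ⟨t', hlt, v', h'⟩
    simp [h.2] at this

theorem ReadiesAt.unique {x : Execution S (Q.bracha V)} {t t' : ℕ} {p : Node} {v v' : V}
    (h : ReadiesAt x t p v) (h' : ReadiesAt x t' p v') : v = v' := by
  rcases lt_trichotomy t t' with hlt | rfl | hlt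
  · have := (readied_iff x t' p).2 ⟨t, hlt, v, h⟩
    simp [h'.1] at this
  -- A step handles a single input, which fixes both the kind of cause and the value.
  · obtain ⟨-, a, h | h⟩ := h <;> obtain ⟨-, b, h' | h'⟩ := h' <;>
      have he := h.1 <;> simp_all
  · have := (readied_iff x t p).2 ⟨t', hlt, v', h'⟩
    simp [h.1] at this

theorem CompletesAt.unique {x : Execution S (Q.bracha V)} {t t' : ℕ} {p : Node} {v v' : V}
    (h : CompletesAt x t p v) (h' : CompletesAt x t' p v') : t = t' ∧ v = v' := by
  rcases lt_trichotomy t t' with hlt | rfl | hlt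
  · have := (delivered_iff x t' p).2 ⟨t, hlt, v, h⟩
    simp [h'.1] at this
  · obtain ⟨-, a, h, -⟩ := h
    obtain ⟨-, b, h', -⟩ := h'
    simp_all
  · have := (delivered_iff x t p).2 ⟨t', hlt, v', h'⟩
    simp [h.1] at this

/-! ### Tracing messages back to their causes -/

/-- Receipt happens at `t` at the latest and sending strictly before it; this strictness drives the
descent in time. -/
theorem exists_readiesAt_of_mem_receivedFrom {x : Execution S (Q.bracha V)} {t : ℕ}
    {p src : Node} {v : V} (hsrc : src ∉ S.byz) (h : src ∈ x.receivedFrom (t + 1) p (.ready v)) :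
    ∃ t' < t, ReadiesAt x t' src v := by
  obtain ⟨t₁, h₁, he⟩ := h
  obtain ⟨t₂, h₂, ho⟩ := x.authentic _ _ _ _ he hsrc
  exact ⟨t₂, by omega, ((hasOutput_ready x).1 ho).1⟩

theorem exists_echoesAt_of_mem_receivedFrom {x : Execution S (Q.bracha V)} {t : ℕ}
    {p src : Node} {v : V} (hsrc : src ∉ S.byz) (h : src ∈ x.receivedFrom (t + 1) p (.echo v)) :
    ∃ t' < t, EchoesAt x t' src v := by
  obtain ⟨t₁, h₁, he⟩ := h
  obtain ⟨t₂, h₂, ho⟩ := x.authentic _ _ _ _ he hsrc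
  exact ⟨t₂, by omega, ((hasOutput_echo x).1 ho).1⟩

theorem EchoesAt.exists_broadcasts {x : Execution S (Q.bracha V)} {t : ℕ} {p : Node} {v : V}
    (h : EchoesAt x t p v) (hs : S.sender ∉ S.byz) : ∃ t' < t, x.Broadcasts t' v := by
  obtain ⟨t', ht', ho⟩ := x.authentic _ _ _ _ h.1 hs
  exact ⟨t', ht', ((hasOutput_bcast x).1 ho).1⟩

/-- A ready message sent by a member of a complete quorum goes back to a quorum of echoes. -/
theorem ReadiesAt.exists_echo_quorum {x : Execution S (Q.bracha V)} {q₀ : Set Node}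
    (hq₀ : Q.IsComplete q₀) {v : V} (t : ℕ) :
    ∀ p ∈ q₀, ReadiesAt x t p v → ∃ u ∈ S.wellBehaved, ∃ q ∈ Q.quorums u,
      ∀ a ∈ q, a ∉ S.byz → ∃ t' < t, EchoesAt x t' a v := by
  induction t using Nat.strong_induction_on with
  | _ t ih =>
    rintro p hp ⟨-, src, ⟨-, q, hq, hsub⟩ | ⟨-, hb⟩⟩
    · exact ⟨p, hq₀.1 hp, q, hq, fun a ha hbz =>
        exists_echoesAt_of_mem_receivedFrom hbz (hsub ha)⟩
    -- The blocking set meets a quorum of `p` inside `q₀`, which yields an earlier ready by a member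
    -- of `q₀`.
    · obtain ⟨q', hq', hsub⟩ := hq₀.2 p hp
      obtain ⟨a, ha, ha'⟩ := hb q' hq'
      obtain ⟨t', ht', hr⟩ := exists_readiesAt_of_mem_receivedFrom (hq₀.1 (hsub ha')).2 ha
      obtain ⟨u, hu, q, hq, h⟩ := ih t' ht' a (hsub ha') hr
      refine ⟨u, hu, q, hq, fun b hb hbz => ?_⟩
      obtain ⟨s, hs, he⟩ := h b hb hbz
      exact ⟨s, by omega, he⟩

/-- Members of a complete quorum send ready messages for the same value only. -/
theorem ReadiesAt.eq_of_mem_complete {x : Execution S (Q.bracha V)}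
    (hQI : Q.QuorumIntersection) {q₀ : Set Node} (hq₀ : Q.IsComplete q₀) {t t' : ℕ} {p p' : Node}
    {v v' : V} (hp : p ∈ q₀) (hp' : p' ∈ q₀) (h : ReadiesAt x t p v) (h' : ReadiesAt x t' p' v') :
    v = v' := by
  obtain ⟨u, hu, q, hq, he⟩ := ReadiesAt.exists_echo_quorum hq₀ t p hp h
  obtain ⟨u', hu', q', hq', he'⟩ := ReadiesAt.exists_echo_quorum hq₀ t' p' hp' h'
  obtain ⟨a, ⟨haq, haq'⟩, haW⟩ := hQI u hu u' hu' q hq q' hq'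
  obtain ⟨_, _, h1⟩ := he a haq haW.2
  obtain ⟨_, _, h2⟩ := he' a haq' haW.2
  exact h1.unique h2

/-! ### Progress from reliable links -/

theorem finite_of_subset_wellBehaved {X : Set Node} (h : X ⊆ S.wellBehaved) : X.Finite :=
  S.finite_procs.subset (h.trans Set.sdiff_subset)

/-- Having `a` in a quorum makes `p` a follower of `a`, hence an addressee. -/
theorem ReadiesAt.exists_receive {x : Execution S (Q.bracha V)} {t : ℕ} {a p : Node} {v : V}
    {q : Set Node} (ha : a ∉ S.byz) (hp : p ∈ S.wellBehaved) (hq : q ∈ Q.quorums p) (haq : a ∈ q)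
    (h : ReadiesAt x t a v) : ∃ t', x.event t' = some (p, .receive a (.ready v)) := by
  obtain ⟨t', -, he⟩ := x.reliable t a p (.ready v) ha hp
    ((hasOutput_ready x).2 ⟨h, hp.1, q, hq, haq⟩)
  exact ⟨t', he⟩

theorem EchoesAt.exists_receive {x : Execution S (Q.bracha V)} {t : ℕ} {a p : Node} {v : V}
    {q : Set Node} (ha : a ∉ S.byz) (hp : p ∈ S.wellBehaved) (hq : q ∈ Q.quorums p) (haq : a ∈ q)
    (h : EchoesAt x t a v) : ∃ t', x.event t' = some (p, .receive a (.echo v)) := by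
  obtain ⟨t', -, he⟩ := x.reliable t a p (.echo v) ha hp
    ((hasOutput_echo x).2 ⟨h, hp.1, q, hq, haq⟩)
  exact ⟨t', he⟩

/-- A process delivers if all members of one of its well-behaved quorums send a ready message. -/
theorem exists_completesAt {x : Execution S (Q.bracha V)} {p : Node} {v : V} {q : Set Node}
    (hp : p ∈ S.wellBehaved) (hq : q ∈ Q.quorums p) (hqW : q ⊆ S.wellBehaved)
    (h : ∀ a ∈ q, ∃ t, ReadiesAt x t a v) : ∃ t v', CompletesAt x t p v' := by
  obtain ⟨t, src, -, he, hsub⟩ := x.exists_last_receive (finite_of_subset_wellBehaved hqW)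
    (Q.quorum_nonempty p hp q hq) (p := p) (m := .ready v) fun a ha => by
      obtain ⟨t, ht⟩ := h a ha
      exact ht.exists_receive (hqW ha).2 hp hq ha
  -- An earlier delivery may be for another value, hence the unspecified `v'`.
  by_cases hd : (localState (Q.bracha V) x.event t p).delivered = true
  · obtain ⟨t', -, h'⟩ := (delivered_iff x t p).1 hd
    exact ⟨t', h'⟩
  · exact ⟨t, v, by simpa using hd, src, he, q, hq, hsub⟩

/-- A process sends a ready message if all members of one of its well-behaved quorums echo. -/
theorem exists_readiesAt_of_echoesAt {x : Execution S (Q.bracha V)} {p : Node} {v : V}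
    {q : Set Node} (hp : p ∈ S.wellBehaved) (hq : q ∈ Q.quorums p) (hqW : q ⊆ S.wellBehaved)
    (h : ∀ a ∈ q, ∃ t, EchoesAt x t a v) : ∃ t v', ReadiesAt x t p v' := by
  obtain ⟨t, src, -, he, hsub⟩ := x.exists_last_receive (finite_of_subset_wellBehaved hqW)
    (Q.quorum_nonempty p hp q hq) (p := p) (m := .echo v) fun a ha => by
      obtain ⟨t, ht⟩ := h a ha
      exact ht.exists_receive (hqW ha).2 hp hq ha
  by_cases hd : (localState (Q.bracha V) x.event t p).readied = true
  · obtain ⟨t', -, h'⟩ := (readied_iff x t p).1 hd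
    exact ⟨t', h'⟩
  · exact ⟨t, v, by simpa using hd, src, .inl ⟨he, q, hq, hsub⟩⟩

/-- If the well-behaved members of a quorum send ready messages for `v`, then every well-behaved
process sends a ready message. -/
theorem exists_readiesAt_of_readiesAt {x : Execution S (Q.bracha V)}
    (hQI : Q.QuorumIntersection) {p p' : Node} {v : V} {q : Set Node} (hp : p ∈ S.wellBehaved)
    (hq : q ∈ Q.quorums p) (h : ∀ a ∈ q, a ∉ S.byz → ∃ t, ReadiesAt x t a v)
    (hp' : p' ∈ S.wellBehaved) : ∃ t v', ReadiesAt x t p' v' := by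
  -- Ready messages reach followers only, so `X` keeps just the members of `q` that `p'` follows;
  -- quorum intersection still makes it blocking.
  let X : Set Node := {a ∈ S.wellBehaved | a ∈ q ∧ ∃ q' ∈ Q.quorums p', a ∈ q'}
  have hX : ∀ q' ∈ Q.quorums p', (X ∩ q').Nonempty := fun q' hq' => by
    obtain ⟨a, ⟨haq, haq'⟩, haW⟩ := hQI p hp p' hp' q hq q' hq'
    exact ⟨a, ⟨haW, haq, q', hq', haq'⟩, haq'⟩
  -- Some quorum is needed for `X` to be non-empty, so that a last receipt exists.
  obtain ⟨q₁, hq₁⟩ := Q.nonempty p' hp'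
  obtain ⟨t, src, -, he, hsub⟩ := x.exists_last_receive (X := X)
    (finite_of_subset_wellBehaved fun a ha => ha.1) ((hX q₁ hq₁).mono Set.inter_subset_left)
    (p := p') (m := .ready v) fun a ⟨haW, haq, q', hq', haq'⟩ => by
      obtain ⟨t, ht⟩ := h a haq haW.2
      exact ht.exists_receive haW.2 hp' hq' haq'
  by_cases hd : (localState (Q.bracha V) x.event t p').readied = true
  · obtain ⟨t', -, h'⟩ := (readied_iff x t p').1 hd
    exact ⟨t', h'⟩
  · exact ⟨t, v, by simpa using hd, src, .inr ⟨he, fun q' hq' =>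
      (hX q' hq').mono (Set.inter_subset_inter_left _ hsub)⟩⟩

theorem CompletesAt.exists_ready_quorum {x : Execution S (Q.bracha V)} {t : ℕ} {p : Node} {v : V}
    (h : CompletesAt x t p v) :
    ∃ q ∈ Q.quorums p, ∀ a ∈ q, a ∉ S.byz → ∃ t' < t, ReadiesAt x t' a v := by
  obtain ⟨-, src, -, q, hq, hsub⟩ := h
  exact ⟨q, hq, fun a ha hb => exists_readiesAt_of_mem_receivedFrom hb (hsub ha)⟩

/-! ### The five properties -/

theorem bracha_noDuplication (x : Execution S (Q.bracha V)) : x.NoDuplication :=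
  fun _ _ _ _ _ _ h h' => ((delivers_iff x).1 h).unique ((delivers_iff x).1 h')

theorem bracha_consistency (hQI : Q.QuorumIntersection) (x : Execution S (Q.bracha V)) :
    x.Consistency := by
  intro p hp p' hp' t t' m m' h h'
  obtain ⟨q, hq, hr⟩ := ((delivers_iff x).1 h).exists_ready_quorum
  obtain ⟨q', hq', hr'⟩ := ((delivers_iff x).1 h').exists_ready_quorum
  obtain ⟨a, ⟨haq, haq'⟩, haW⟩ := hQI p hp p' hp' q hq q' hq'
  obtain ⟨_, _, h1⟩ := hr a haq haW.2
  obtain ⟨_, _, h2⟩ := hr' a haq' haW.2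
  exact h1.unique h2

theorem ReadiesAt.exists_broadcasts {x : Execution S (Q.bracha V)} (hQI : Q.QuorumIntersection)
    {q₀ : Set Node} (hq₀ : Q.IsComplete q₀) {t : ℕ} {p : Node} {v : V} (hp : p ∈ q₀)
    (h : ReadiesAt x t p v) (hs : S.sender ∉ S.byz) : ∃ t' < t, x.Broadcasts t' v := by
  obtain ⟨u, hu, q, hq, he⟩ := ReadiesAt.exists_echo_quorum hq₀ t p hp h
  -- Intersecting `q` with itself gives a well-behaved member.
  obtain ⟨a, ⟨haq, -⟩, haW⟩ := hQI u hu u hu q hq q hq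
  obtain ⟨t₁, h₁, hecho⟩ := he a haq haW.2
  obtain ⟨t₂, h₂, hb⟩ := hecho.exists_broadcasts hs
  exact ⟨t₂, h₂.trans h₁, hb⟩

theorem bracha_integrity (hQI : Q.QuorumIntersection) {p₀ : Node} (hp₀ : p₀ ∈ S.wellBehaved)
    {q₀ : Set Node} (hq₀ : q₀ ∈ Q.quorums p₀) (hc : Q.IsComplete q₀)
    (x : Execution S (Q.bracha V)) : x.Integrity := by
  intro hs p hp t m h
  obtain ⟨q, hq, hr⟩ := ((delivers_iff x).1 h).exists_ready_quorum
  obtain ⟨a, ⟨haq, haq₀⟩, haW⟩ := hQI p hp p₀ hp₀ q hq q₀ hq₀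
  obtain ⟨t₁, h₁, hready⟩ := hr a haq haW.2
  obtain ⟨t₂, h₂, hb⟩ := hready.exists_broadcasts hQI hc haq₀ hs
  exact ⟨t₂, h₂.trans h₁, hb⟩

theorem bracha_totality (hQI : Q.QuorumIntersection) {P : Set Node} (hPW : P ⊆ S.wellBehaved)
    (hSA : Q.StrongAvailability P) (x : Execution S (Q.bracha V)) : x.Totality P := by
  rintro ⟨p, hp, t, m, h⟩ p₀ hp₀
  obtain ⟨q₀, hq₀, hc⟩ := hSA p₀ hp₀
  obtain ⟨q, hq, hr⟩ := ((delivers_iff x).1 h).exists_ready_quorum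
  obtain ⟨a, ⟨haq, haq₀⟩, haW⟩ := hQI p hp p₀ (hPW hp₀) q hq q₀ hq₀
  obtain ⟨t₁, -, hready⟩ := hr a haq haW.2
  obtain ⟨t', m', hd⟩ := exists_completesAt (x := x) (v := m) (hPW hp₀) hq₀ hc.1 fun b hb => by
    obtain ⟨s, v, hs⟩ := exists_readiesAt_of_readiesAt hQI hp hq
      (fun c hcq hcb => (hr c hcq hcb).imp fun _ h => h.2) (hc.1 hb)
    -- The value readied by `b` is a priori unknown; agreement with `a` inside `q₀` forces it to be
    -- `m`.
    obtain rfl := hs.eq_of_mem_complete hQI hc hb haq₀ hready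
    exact ⟨s, hs⟩
  exact ⟨t', m', (delivers_iff x).2 hd⟩

theorem broadcasts_unique (x : Execution S (Q.bracha V)) {t t' : ℕ} {m m' : V}
    (h : x.Broadcasts t m) (h' : x.Broadcasts t' m') : t = t' ∧ m = m' := by
  obtain rfl := x.request_once _ _ _ _ _ _ h h'
  simpa using (Eq.symm h).trans h'

/-- Every well-behaved process echoes the message that a well-behaved sender broadcasts. -/
theorem exists_echoesAt_of_broadcasts {x : Execution S (Q.bracha V)} (hs : S.sender ∉ S.byz)
    {t : ℕ} {m : V} (h : x.Broadcasts t m) {p : Node} (hp : p ∈ S.wellBehaved) :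
    ∃ t', EchoesAt x t' p m := by
  obtain ⟨t₁, -, he⟩ := x.reliable t S.sender p (.bcast m) hs hp
    ((hasOutput_bcast x).2 ⟨h, hp.1⟩)
  by_cases hd : (localState (Q.bracha V) x.event t₁ p).echoed = true
  -- An earlier echo also stems from the only broadcast.
  · obtain ⟨t₂, -, v, h₂⟩ := (echoed_iff x t₁ p).1 hd
    obtain ⟨t₃, -, hb⟩ := h₂.exists_broadcasts hs
    obtain ⟨-, rfl⟩ := broadcasts_unique x h hb
    exact ⟨t₂, h₂⟩
  · exact ⟨t₁, he, by simpa using hd⟩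

theorem bracha_validity (hQI : Q.QuorumIntersection) {P : Set Node} (hPW : P ⊆ S.wellBehaved)
    (hSA : Q.StrongAvailability P) (x : Execution S (Q.bracha V)) : x.Validity P := by
  intro hs t m h p₀ hp₀
  obtain ⟨q₀, hq₀, hc⟩ := hSA p₀ hp₀
  obtain ⟨t', m', hd⟩ := exists_completesAt (x := x) (v := m) (hPW hp₀) hq₀ hc.1 fun b hb => by
    obtain ⟨q, hq, hsub⟩ := hc.2 b hb
    obtain ⟨s, v, hr⟩ := exists_readiesAt_of_echoesAt (x := x) (v := m) (hc.1 hb) hq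
      (hsub.trans hc.1) fun a ha => exists_echoesAt_of_broadcasts hs h (hc.1 (hsub ha))
    obtain ⟨_, -, hb'⟩ := hr.exists_broadcasts hQI hc hb hs
    obtain ⟨-, rfl⟩ := broadcasts_unique x h hb'
    exact ⟨s, hr⟩
  -- Integrity and the single request identify the delivered value and place the delivery after `t`.
  have hdel := (delivers_iff x).2 hd
  obtain ⟨t₁, h₁, hb⟩ := bracha_integrity hQI (hPW hp₀) hq₀ hc x hs p₀ (hPW hp₀) t' m' hdel
  obtain ⟨rfl, rfl⟩ := broadcasts_unique x h hb
  exact ⟨t', h₁, hdel⟩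

end QuorumSystem

theorem mainTheorem3 {Node V : Type*} (S : BSystem Node) (Q : QuorumSystem S) (P : Set Node)
    (hPne : P.Nonempty) (hPW : P ⊆ S.wellBehaved)
    (hQI : Q.QuorumIntersection) (hSA : Q.StrongAvailability P) :
    ImplementsBRB S (Q.bracha V) P := by
  intro x
  obtain ⟨p₀, hp₀⟩ := hPne
  obtain ⟨q₀, hq₀, hc⟩ := hSA p₀ hp₀
  exact ⟨QuorumSystem.bracha_validity hQI hPW hSA x,
    QuorumSystem.bracha_integrity hQI (hPW hp₀) hq₀ hc x,
    QuorumSystem.bracha_totality hQI hPW hSA x,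
    QuorumSystem.bracha_consistency hQI x,
    QuorumSystem.bracha_noDuplication x⟩
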